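/- All $C^*$-algebras and $*$-homomorphisms are over $\mathbb{C}$. For a unital $C^*$-algebra $\mathcal{A}$ write $\mathcal{A}_\infty = \ell^\infty(\mathbb{N},\mathcal{A})/C_0(\mathbb{N},\mathcal{A})$, where $C_0(\mathbb{N},\mathcal{A})$ is the ideal of sequences converging to $0$ in norm; view $\mathcal{A}$ inside $\ell^\infty(\mathbb{N},\mathcal{A})$ and $\mathcal{A}_\infty$ as (classes of) constant sequences, and let $\mathcal{A}_\infty\cap\mathcal{A}'$ be the relative commutant of $\mathcal{A}$ in $\mathcal{A}_\infty$ (the central sequence algebra). An action $\alpha$ of a group $G$ on $\mathcal{A}$ by $*$-automorphisms induces, termwise, actions $\bar\alpha$ of $G$ on $\ell^\infty(\mathbb{N},\mathcal{A})$, $\mathcal{A}_\infty$ and $\mathcal{A}_\infty\cap\mathcal{A}'$. When $G$ is a topological group, let $\ell^{\infty,(\alpha)}(\mathbb{N},\mathcal{A})$ be the set of $x\in\ell^\infty(\mathbb{N},\mathcal{A})$ for which $g\mapsto\bar\alpha_g(x)$ is norm continuous, and let $\mathcal{A}_\infty^{(\alpha)}\subseteq\mathcal{A}_\infty$ be its image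 in $\mathcal{A}_\infty$. An embedding is an injective $*$-homomorphism. A strongly continuous action $\alpha$ (i.e. $g\mapsto\alpha_g(a)$ is norm continuous for each $a\in\mathcal{A}$) of a compact Hausdorff second countable group $G$ on a separable unital $C^*$-algebra $\mathcal{A}$ has the Rokhlin property if there is a unital embedding $\theta: C(G)\to\mathcal{A}_\infty^{(\alpha)}\cap\mathcal{A}'$ such that $\bar\alpha_g(\theta(f))=\theta\big(h\mapsto f(g^{-1}h)\big)$ for all $f\in C(G)$ and $g\in G$. **Theorem.** Let $\mathcal{A}$ be a separable unital $C^*$-algebra, let $G$ be a compact Hausdorff second countable group, and let $\alpha:G\to\mathrm{Aut}(\mathcal{A})$ be a strongly continuous action with the Rokhlin property. Let $\mathcal{B}$ be a separable unital $C^*$-algebra which admits a central sequence of unital embeddings into $\mathcal{A}$, i.e. there are unital embeddings $\psi_n:\mathcal{B}\to\mathcal{A}$, $n\in\mathbb{N}$, with $\|\psi_n(b)a-a\psi_n(b)\|\to 0$ for all $b\in\mathcal{B}$ and $a\in\mathcal{A}$. Then there is a unital embedding of $\mathcal{B}$ into the fixed point subalgebra $\{x\in\mathcal{A}_\infty\cap\mathcal{A}'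 : \bar\alpha_g(x)=x \text{ for all } g\in G\}$. -/

import Mathlib

open Filter Topology BoundedContinuousFunction

noncomputable section

namespace CentralSeq

universe u v

/-- `ℓ^∞(ℕ, A)`: the C⋆-algebra of bounded sequences in `A`, realised as the bounded (automatically
continuous) functions on the discrete space `ℕ`, with the pointwise operations and sup norm. -/
abbrev EllInfty (A : Type u) [CStarAlgebra A] : Type u := ℕ →ᵇ A

/-- `C₀(ℕ, A)`: the ideal of `ℓ^∞(ℕ, A)` of sequences converging to zero in norm. -/
def cZero (A : Type u) [CStarAlgebra A] : Ideal (EllInfty A) where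
  carrier := {x | Tendsto (fun n => ‖x n‖) atTop (𝓝 0)}
  zero_mem' := by simp
  add_mem' := by
    intro x y hx hy
    have h := Tendsto.add hx hy
    rw [add_zero] at h
    exact squeeze_zero (fun n => norm_nonneg _) (fun n => norm_add_le (x n) (y n)) h
  smul_mem' := by
    intro c x hx
    have h := Tendsto.const_mul ‖c‖ hx
    rw [mul_zero] at h
    refine squeeze_zero (fun n => norm_nonneg _) (fun n => ?_) h
    exact (norm_mul_le (c n) (x n)).trans
      (mul_le_mul_of_nonneg_right (c.norm_coe_le_norm n) (norm_nonneg _))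

theorem mem_cZero {A : Type u} [CStarAlgebra A] {x : EllInfty A} :
    x ∈ cZero A ↔ Tendsto (fun n => ‖x n‖) atTop (𝓝 0) := Iff.rfl

instance cZero_isTwoSided (A : Type u) [CStarAlgebra A] : (cZero A).IsTwoSided where
  mul_mem_of_left := by
    intro x c hx
    have h := Tendsto.mul_const ‖c‖ (mem_cZero.1 hx)
    rw [zero_mul] at h
    refine squeeze_zero (fun n => norm_nonneg _) (fun n => ?_) h
    exact (norm_mul_le (x n) (c n)).trans
      (mul_le_mul_of_nonneg_left (c.norm_coe_le_norm n) (norm_nonneg _))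

theorem star_mem_cZero {A : Type u} [CStarAlgebra A] {x : EllInfty A} (hx : x ∈ cZero A) :
    star x ∈ cZero A := by
  rw [mem_cZero] at hx ⊢
  simpa using hx

/-- The sequence algebra `A_∞ = ℓ^∞(ℕ, A) / C₀(ℕ, A)`. -/
abbrev AInfty (A : Type u) [CStarAlgebra A] : Type u := EllInfty A ⧸ cZero A

/-- The quotient map `ℓ^∞(ℕ, A) → A_∞` as a ring homomorphism. -/
abbrev mkRingHom (A : Type u) [CStarAlgebra A] : EllInfty A →+* AInfty A :=
  Ideal.Quotient.mk (cZero A)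

/-- The involution of `A_∞`, induced from `ℓ^∞(ℕ, A)`. -/
instance instStarAInfty (A : Type u) [CStarAlgebra A] : Star (AInfty A) where
  star := Quotient.lift (fun x => mkRingHom A (star x)) (by
    intro x y hxy
    have h : x - y ∈ cZero A := (Submodule.quotientRel_def _).1 hxy
    refine Ideal.Quotient.eq.2 ?_
    rw [← star_sub]
    exact star_mem_cZero h)

theorem star_mk {A : Type u} [CStarAlgebra A] (x : EllInfty A) :
    star (mkRingHom A x) = mkRingHom A (star x) := rfl

instance instStarRingAInfty (A : Type u) [CStarAlgebra A] : StarRing (AInfty A) where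
  star_involutive := by
    intro x
    obtain ⟨x, rfl⟩ := Ideal.Quotient.mk_surjective x
    rw [star_mk, star_mk, star_star]
  star_mul := by
    intro x y
    obtain ⟨x, rfl⟩ := Ideal.Quotient.mk_surjective x
    obtain ⟨y, rfl⟩ := Ideal.Quotient.mk_surjective y
    rw [← map_mul, star_mk, star_mk, star_mk, star_mul, map_mul]
  star_add := by
    intro x y
    obtain ⟨x, rfl⟩ := Ideal.Quotient.mk_surjective x
    obtain ⟨y, rfl⟩ := Ideal.Quotient.mk_surjective y
    rw [← map_add, star_mk, star_mk, star_mk, star_add, map_add]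

theorem smul_mk {A : Type u} [CStarAlgebra A] (c : ℂ) (x : EllInfty A) :
    c • mkRingHom A x = mkRingHom A (c • x) := rfl

instance instStarModuleAInfty (A : Type u) [CStarAlgebra A] : StarModule ℂ (AInfty A) where
  star_smul := by
    intro c x
    obtain ⟨x, rfl⟩ := Ideal.Quotient.mk_surjective x
    rw [smul_mk, star_mk, star_mk, smul_mk, star_smul]

/-- The quotient map `π : ℓ^∞(ℕ, A) → A_∞` as a unital ⋆-homomorphism. -/
def proj (A : Type u) [CStarAlgebra A] : EllInfty A →⋆ₐ[ℂ] AInfty A where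
  toRingHom := mkRingHom A
  commutes' := fun _ => rfl
  map_star' := fun _ => rfl

/-- The embedding of `A` into `ℓ^∞(ℕ, A)` as constant sequences. -/
def constSeq (A : Type u) [CStarAlgebra A] : A →⋆ₐ[ℂ] EllInfty A where
  toFun a := BoundedContinuousFunction.const ℕ a
  map_one' := rfl
  map_mul' _ _ := rfl
  map_zero' := rfl
  map_add' _ _ := rfl
  commutes' _ := rfl
  map_star' _ := rfl

/-- The canonical embedding `ι_A` of `A` into `A_∞`. -/
def iota (A : Type u) [CStarAlgebra A] : A →⋆ₐ[ℂ] AInfty A := (proj A).comp (constSeq A)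

/-- The ⋆-endomorphism of `ℓ^∞(ℕ, A)` obtained by applying a ⋆-endomorphism of `A` termwise. -/
def ellMap {A : Type u} [CStarAlgebra A] (σ : A →⋆ₐ[ℂ] A) : EllInfty A →⋆ₐ[ℂ] EllInfty A where
  toFun x := BoundedContinuousFunction.ofNormedAddCommGroup (fun n => σ (x n))
    continuous_of_discreteTopology ‖x‖
    (fun n => (NonUnitalStarAlgHom.norm_apply_le σ (x n)).trans (x.norm_coe_le_norm n))
  map_one' := by ext n; exact map_one σ
  map_mul' x y := by ext n; exact map_mul σ (x n) (y n)
  map_zero' := by ext n; exact map_zero σ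
  map_add' x y := by ext n; exact map_add σ (x n) (y n)
  commutes' c := by ext n; exact AlgHomClass.commutes σ c
  map_star' x := by ext n; exact map_star σ (x n)

theorem ellMap_apply {A : Type u} [CStarAlgebra A] (σ : A →⋆ₐ[ℂ] A) (x : EllInfty A) (n : ℕ) :
    ellMap σ x n = σ (x n) := rfl

theorem ellMap_mem_cZero {A : Type u} [CStarAlgebra A] (σ : A →⋆ₐ[ℂ] A) {x : EllInfty A}
    (hx : x ∈ cZero A) : ellMap σ x ∈ cZero A :=
  squeeze_zero (fun _ => norm_nonneg _)
    (fun n => NonUnitalStarAlgHom.norm_apply_le σ (x n)) (mem_cZero.1 hx)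

/-- The ring endomorphism of `A_∞` induced by a ⋆-endomorphism of `A`. -/
def inftyRingHom {A : Type u} [CStarAlgebra A] (σ : A →⋆ₐ[ℂ] A) : AInfty A →+* AInfty A :=
  Ideal.Quotient.lift (cZero A) ((mkRingHom A).comp (ellMap σ).toAlgHom.toRingHom)
    (fun _ hx => Ideal.Quotient.eq_zero_iff_mem.2 (ellMap_mem_cZero σ hx))

theorem inftyRingHom_mk {A : Type u} [CStarAlgebra A] (σ : A →⋆ₐ[ℂ] A) (x : EllInfty A) :
    inftyRingHom σ (mkRingHom A x) = mkRingHom A (ellMap σ x) := rfl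

/-- The ⋆-endomorphism of `A_∞` induced by a ⋆-endomorphism of `A`. -/
def inftyMap {A : Type u} [CStarAlgebra A] (σ : A →⋆ₐ[ℂ] A) : AInfty A →⋆ₐ[ℂ] AInfty A where
  toRingHom := inftyRingHom σ
  commutes' c := by
    have h : inftyRingHom σ (mkRingHom A (algebraMap ℂ (EllInfty A) c)) =
        mkRingHom A (algebraMap ℂ (EllInfty A) c) := by
      rw [inftyRingHom_mk, AlgHomClass.commutes]
    exact h
  map_star' x := by
    obtain ⟨x, rfl⟩ := Ideal.Quotient.mk_surjective x
    have h : inftyRingHom σ (star (mkRingHom A x)) = star (inftyRingHom σ (mkRingHom A x)) := by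
      rw [star_mk, inftyRingHom_mk, inftyRingHom_mk, star_mk, map_star]
    exact h

theorem inftyMap_proj {A : Type u} [CStarAlgebra A] (σ : A →⋆ₐ[ℂ] A) (x : EllInfty A) :
    inftyMap σ (proj A x) = proj A (ellMap σ x) := rfl

/-- The central sequence algebra `A_∞ ∩ A'`: the relative commutant in `A_∞` of (the image
under `ι_A` of) `A`. -/
def centralSeqAlgebra (A : Type u) [CStarAlgebra A] : StarSubalgebra ℂ (AInfty A) :=
  StarSubalgebra.centralizer ℂ (Set.range (iota A))

section Action

variable {G : Type v} [Group G] {A : Type u} [CStarAlgebra A]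

/-- The automorphism `\bar α_g` of `ℓ^∞(ℕ, A)` induced by an action `α` of `G` on `A`. -/
def ellAction (α : G →* (A ≃⋆ₐ[ℂ] A)) (g : G) : EllInfty A →⋆ₐ[ℂ] EllInfty A :=
  ellMap (α g : A →⋆ₐ[ℂ] A)

/-- The automorphism `\bar α_g` of `A_∞` induced by an action `α` of `G` on `A`. -/
def inftyAction (α : G →* (A ≃⋆ₐ[ℂ] A)) (g : G) : AInfty A →⋆ₐ[ℂ] AInfty A :=
  inftyMap (α g : A →⋆ₐ[ℂ] A)

/-- Strong continuity: `g ↦ α_g(a)` is norm continuous for every `a ∈ A`. -/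
def StronglyContinuous [TopologicalSpace G] (α : G →* (A ≃⋆ₐ[ℂ] A)) : Prop :=
  ∀ a : A, Continuous fun g => α g a

/-- `ℓ^{∞,(α)}(ℕ, A)`: the elements `x` of `ℓ^∞(ℕ, A)` on which the induced action is continuous,
i.e. for which `g ↦ \bar α_g(x)` is continuous for the sup norm. -/
def ellContinuous [TopologicalSpace G] (α : G →* (A ≃⋆ₐ[ℂ] A)) :
    StarSubalgebra ℂ (EllInfty A) where
  carrier := {x | Continuous fun g => ellAction α g x}
  mul_mem' := by
    intro x y hx hy
    have h : Continuous fun g => ellAction α g x * ellAction α g y := Continuous.mul hx hy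
    change Continuous fun g => ellAction α g (x * y)
    simpa only [map_mul] using h
  add_mem' := by
    intro x y hx hy
    have h : Continuous fun g => ellAction α g x + ellAction α g y := Continuous.add hx hy
    change Continuous fun g => ellAction α g (x + y)
    simpa only [map_add] using h
  algebraMap_mem' := by
    intro c
    have h : Continuous fun _ : G => algebraMap ℂ (EllInfty A) c := continuous_const
    have e : (fun g => ellAction α g (algebraMap ℂ (EllInfty A) c)) =
        fun _ : G => algebraMap ℂ (EllInfty A) c :=
      funext fun g => AlgHomClass.commutes (ellAction α g) c
    change Continuous fun g => ellAction α g (algebraMap ℂ (EllInfty A) c)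
    rw [e]
    exact h
  star_mem' := by
    intro x hx
    have h : Continuous fun g => star (ellAction α g x) := Continuous.star hx
    change Continuous fun g => ellAction α g (star x)
    simpa only [map_star] using h

/-- `A_∞^{(α)} = ℓ^{∞,(α)}(ℕ, A) / C₀(ℕ, A)`, realised inside `A_∞` as the image of
`ℓ^{∞,(α)}(ℕ, A)` under the quotient map. -/
def inftyContinuous [TopologicalSpace G] (α : G →* (A ≃⋆ₐ[ℂ] A)) :
    StarSubalgebra ℂ (AInfty A) :=
  (ellContinuous α).map (proj A)

/-- The Rokhlin property for a strongly continuous action `α` of a compact group `G` on `A`: there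
is a unital embedding `θ` of `C(G)` into `A_∞^{(α)} ∩ A'` which intertwines left translation
`f ↦ (h ↦ f(g⁻¹h))` with the induced action `\bar α`. -/
def HasRokhlinProperty [TopologicalSpace G] [IsTopologicalGroup G] (α : G →* (A ≃⋆ₐ[ℂ] A)) :
    Prop :=
  ∃ θ : C(G, ℂ) →⋆ₐ[ℂ] (inftyContinuous α ⊓ centralSeqAlgebra A : StarSubalgebra ℂ (AInfty A)),
    Function.Injective θ ∧
      ∀ (g : G) (f : C(G, ℂ)),
        inftyAction α g (θ f : AInfty A) = (θ (f.comp (ContinuousMap.mulLeft g⁻¹)) : AInfty A)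

/-- The fixed point subalgebra of `A_∞ ∩ A'` under the action of `G` induced by `α`. -/
def fixedCentralSeqAlgebra (α : G →* (A ≃⋆ₐ[ℂ] A)) : StarSubalgebra ℂ (AInfty A) where
  carrier := {x | x ∈ centralSeqAlgebra A ∧ ∀ g : G, inftyAction α g x = x}
  mul_mem' := by
    rintro x y ⟨hx, hx'⟩ ⟨hy, hy'⟩
    exact ⟨mul_mem hx hy, fun g => by rw [map_mul, hx', hy']⟩
  add_mem' := by
    rintro x y ⟨hx, hx'⟩ ⟨hy, hy'⟩
    exact ⟨add_mem hx hy, fun g => by rw [map_add, hx', hy']⟩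
  algebraMap_mem' := by
    intro c
    exact ⟨algebraMap_mem _ c, fun g => AlgHomClass.commutes _ c⟩
  star_mem' := by
    rintro x ⟨hx, hx'⟩
    exact ⟨star_mem hx, fun g => by rw [map_star, hx']⟩

end Action

/-- `B` admits a central sequence of unital embeddings into `A`: there are injective unital
⋆-homomorphisms `ψ_n : B → A` with `‖[ψ_n(b), a]‖ → 0` for all `b ∈ B`, `a ∈ A`. -/
def AdmitsCentralSequence (B : Type v) (A : Type u) [CStarAlgebra B] [CStarAlgebra A] : Prop :=
  ∃ ψ : ℕ → (B →⋆ₐ[ℂ] A), (∀ n, Function.Injective (ψ n)) ∧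
    ∀ (b : B) (a : A), Tendsto (fun n => ‖ψ n b * a - a * ψ n b‖) atTop (𝓝 0)

end CentralSeq

end

noncomputable section

namespace CentralSeq

/-! ### Norm estimates for sums of conjugates in a C⋆-algebra. -/

section ConjugateSums

/-! For `c` in `A`, the orbit function `h ↦ α_h(c)` is fixed by the diagonal action on `C(G, A) =
C(G) ⊗ A`, and it depends on `c` through a ⋆-homomorphism. A Rokhlin map `θ` commutes with `A`, so
`f ⊗ a ↦ θ(f) a` carries `C(G, A)` equivariantly into `A_∞` and sends orbit functions to fixed
points. Taking `c = ψ_n(b)` with `n` large makes the result nearly central, since by compactness the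
whole orbit of `c` nearly commutes with a given element of `A`.

The tensor product is avoided by discretising: with a partition of unity `∑ f_i² = 1` subordinate to
small translates `x_i U`, and lifts of the `θ(f_i)` having terms `s_i`, the orbit function becomes
`∑ s_i⋆ α_{x_i}(c) s_i`. All errors are sums of conjugates, which `norm_sum_star_mul_mul_le` bounds
independently of the number of terms (`eventually_norm_le_of_proj_eq_sum`).

The product map need not be faithful on orbit functions: for translation on `A = C(G)` with `θ`
given by constant sequences, the orbit function of `c` goes to the scalar `c(1)`. The base point is
therefore moved to some `x_l⁻¹`. Averaging over `l` returns `c`, so some `l` keeps a fixed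
proportion of the norm (`eventually_exists_norm_le_translateMap`). As `l` depends on the vector, the
final diagonal sequence tests each vector of a dense sequence infinitely often. -/

theorem norm_le_of_neg_algebraMap_le_of_le_algebraMap {A : Type*} [CStarAlgebra A] [PartialOrder A]
    [StarOrderedRing A] {x : A} {r : ℝ} (hx : IsSelfAdjoint x) (hr : 0 ≤ r)
    (h₁ : -algebraMap ℝ A r ≤ x) (h₂ : x ≤ algebraMap ℝ A r) : ‖x‖ ≤ r := by
  obtain (h | h) := subsingleton_or_nontrivial A
  · simpa [Subsingleton.elim x 0] using hr
  have h₁' : algebraMap ℝ A (-r) ≤ x := by simpa using h₁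
  rw [algebraMap_le_iff_le_spectrum] at h₁'
  rw [le_algebraMap_iff_spectrum_le] at h₂
  rcases CStarAlgebra.norm_or_neg_norm_mem_spectrum hx with h | h
  · exact h₂ _ h
  · exact neg_le_neg_iff.1 (h₁' _ h)

/-- Conjugation preserves order, so `-M ≤ a p ≤ M` sums to a bound between `-M S` and `M S`, where
`S = ∑ (s p)⋆ (s p) ≤ ‖S‖`. -/
theorem norm_sum_star_mul_mul_le_of_isSelfAdjoint {A : Type*} [CStarAlgebra A] {P : Type*}
    (t : Finset P) (s a : P → A) {M : ℝ} (hM : 0 ≤ M) (ha : ∀ p ∈ t, ‖a p‖ ≤ M)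
    (hsa : ∀ p ∈ t, IsSelfAdjoint (a p)) :
    ‖∑ p ∈ t, star (s p) * a p * s p‖ ≤ M * ‖∑ p ∈ t, star (s p) * s p‖ := by
  let _ := CStarAlgebra.spectralOrder A
  have := CStarAlgebra.spectralOrderedRing A
  set S := ∑ p ∈ t, star (s p) * s p with hS
  have hSsa : IsSelfAdjoint S := isSelfAdjoint_sum _ fun p _ => IsSelfAdjoint.star_mul_self (s p)
  have hSle : algebraMap ℝ A M * S ≤ algebraMap ℝ A (M * ‖S‖) := by
    rw [← Algebra.smul_def, Algebra.algebraMap_eq_smul_one, mul_smul]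
    refine smul_le_smul_of_nonneg_left ?_ hM
    rw [← Algebra.algebraMap_eq_smul_one]
    exact hSsa.le_algebraMap_norm_self
  have hMS : algebraMap ℝ A M * S = ∑ p ∈ t, star (s p) * algebraMap ℝ A M * s p := by
    rw [hS, Finset.mul_sum]
    refine Finset.sum_congr rfl fun p _ => ?_
    rw [← mul_assoc, Algebra.commutes M (star (s p))]
  have hmono : ∀ p ∈ t, algebraMap ℝ A ‖a p‖ ≤ algebraMap ℝ A M := fun p hp =>
    algebraMap_mono A (ha p hp)
  refine norm_le_of_neg_algebraMap_le_of_le_algebraMap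
    (isSelfAdjoint_sum _ fun p hp => (hsa p hp).conjugate' (s p))
    (mul_nonneg hM (norm_nonneg _)) ?_ ?_
  · refine (neg_le_neg hSle).trans ?_
    rw [hMS, ← Finset.sum_neg_distrib]
    refine Finset.sum_le_sum fun p hp => ?_
    rw [← neg_mul, ← mul_neg]
    exact star_left_conjugate_le_conjugate
      ((neg_le_neg (hmono p hp)).trans (hsa p hp).neg_algebraMap_norm_le_self) _
  · refine le_trans ?_ hSle
    rw [hMS]
    refine Finset.sum_le_sum fun p hp => ?_
    exact star_left_conjugate_le_conjugate
      ((hsa p hp).le_algebraMap_norm_self.trans (hmono p hp)) _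

/-- The factor 2 is the cost of splitting into real and imaginary parts. What matters is that the
bound ignores the size of `t`: partitions of unity grow as the tolerance shrinks. -/
theorem norm_sum_star_mul_mul_le {A : Type*} [CStarAlgebra A] {P : Type*}
    (t : Finset P) (s a : P → A) {M : ℝ} (hM : 0 ≤ M) (ha : ∀ p ∈ t, ‖a p‖ ≤ M) :
    ‖∑ p ∈ t, star (s p) * a p * s p‖ ≤ 2 * M * ‖∑ p ∈ t, star (s p) * s p‖ := by
  have hre := norm_sum_star_mul_mul_le_of_isSelfAdjoint t s (fun p => (realPart (a p) : A)) hM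
    (fun p hp => (realPart.norm_le (a p)).trans (ha p hp)) (fun p _ => (realPart (a p)).2)
  have him := norm_sum_star_mul_mul_le_of_isSelfAdjoint t s (fun p => (imaginaryPart (a p) : A)) hM
    (fun p hp => (imaginaryPart.norm_le (a p)).trans (ha p hp)) (fun p _ => (imaginaryPart (a p)).2)
  have hsplit : ∑ p ∈ t, star (s p) * a p * s p =
      ∑ p ∈ t, star (s p) * (realPart (a p) : A) * s p +
        Complex.I • ∑ p ∈ t, star (s p) * (imaginaryPart (a p) : A) * s p := by
    rw [Finset.smul_sum, ← Finset.sum_add_distrib]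
    refine Finset.sum_congr rfl fun p _ => ?_
    conv_lhs => rw [← realPart_add_I_smul_imaginaryPart (a p)]
    simp [mul_add, add_mul]
  rw [hsplit]
  refine (norm_add_le _ _).trans ?_
  rw [norm_smul, Complex.norm_I, one_mul]
  linarith

end ConjugateSums

/-! ### Partitions of unity and uniformity over a compact group. -/

section CompactGroups

theorem norm_action_apply {G : Type*} [Group G] {A : Type*} [CStarAlgebra A]
    (α : G →* (A ≃⋆ₐ[ℂ] A)) (g : G) (a : A) : ‖α g a‖ = ‖a‖ :=
  StarAlgEquiv.norm_map (α g) a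

theorem action_mul_apply {G : Type*} [Group G] {A : Type*} [CStarAlgebra A]
    (α : G →* (A ≃⋆ₐ[ℂ] A)) (g h : G) (a : A) :
    α (g * h) a = α g (α h a) := by
  rw [map_mul]
  rfl

variable {G : Type*} [Group G] [TopologicalSpace G] [IsTopologicalGroup G] [CompactSpace G]

/-- A partition of unity by squares, subordinate to finitely many left translates of `U`. -/
theorem exists_sq_partition_subordinate_translates [T2Space G] {U : Set G} (hU : U ∈ 𝓝 (1 : G)) :
    ∃ (t : Finset G) (f : t → C(G, ℂ)), (∀ i, star (f i) = f i) ∧ ∑ i, f i * f i = 1 ∧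
      ∀ i y, f i y ≠ 0 → (i : G)⁻¹ * y ∈ U := by
  obtain ⟨V, hVU, hVo, h1V⟩ := mem_nhds_iff.1 hU
  have hopen : ∀ x : G, IsOpen ((fun y => x⁻¹ * y) ⁻¹' V) := fun x =>
    hVo.preimage (continuous_const_mul _)
  obtain ⟨t, ht⟩ := isCompact_univ.elim_finite_subcover (fun x : G => (fun y => x⁻¹ * y) ⁻¹' V)
    hopen fun x _ => Set.mem_iUnion.2 ⟨x, by simpa using h1V⟩
  obtain ⟨ρ, hρ⟩ := PartitionOfUnity.exists_isSubordinate (s := (Set.univ : Set G)) isClosed_univ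
    (fun x : t => (fun y => (x : G)⁻¹ * y) ⁻¹' V) (fun x => hopen x) (fun y hy => by
      obtain ⟨x, hx, hxy⟩ := Set.mem_iUnion₂.1 (ht hy)
      exact Set.mem_iUnion.2 ⟨⟨x, hx⟩, hxy⟩)
  -- Square roots of the partition functions let each weight be split evenly on both sides of a
  -- conjugate.
  refine ⟨t, fun i => ⟨fun y => ((Real.sqrt (ρ i y) : ℝ) : ℂ), by fun_prop⟩, ?_, ?_, ?_⟩
  · intro i
    ext y
    simp
  · ext y
    have h := ρ.sum_eq_one (Set.mem_univ y)
    rw [finsum_eq_sum_of_fintype] at h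
    simp only [ContinuousMap.coe_sum, Finset.sum_apply, ContinuousMap.mul_apply,
      ContinuousMap.coe_mk, ContinuousMap.one_apply]
    rw [← Complex.ofReal_one, ← h, Complex.ofReal_sum]
    refine Finset.sum_congr rfl fun i _ => ?_
    rw [← Complex.ofReal_mul, Real.mul_self_sqrt (ρ.nonneg i y)]
  · intro i y hy
    refine hVU (hρ i (subset_tsupport _ ?_))
    intro h0
    exact hy (by simp [h0])

variable {A : Type*} [CStarAlgebra A] {α : G →* (A ≃⋆ₐ[ℂ] A)}

/-- Near the identity a strongly continuous action moves all points of an orbit uniformly little. -/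
theorem StronglyContinuous.eventually_forall_norm_sub_lt (hα : StronglyContinuous α) (c : A)
    {δ : ℝ} (hδ : 0 < δ) : ∀ᶠ u in 𝓝 (1 : G), ∀ x : G, ‖α u (α x c) - α x c‖ < δ := by
  have h := (isCompact_univ (X := G)).eventually_forall_of_forall_eventually (x₀ := (1 : G))
    (P := fun u x => ‖α u (α x c) - α x c‖ < δ) (fun x _ => by
      have hc : Continuous fun z : G × G => ‖α (z.1 * z.2) c - α z.2 c‖ :=
        (((hα c).comp continuous_mul).sub ((hα c).comp continuous_snd)).norm
      have := (hc.tendsto ((1 : G), x)).eventually_lt_const (v := ‖α (1 * x) c - α x c‖) (u := δ)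
        (by simpa using hδ)
      filter_upwards [this] with z hz
      rwa [← action_mul_apply])
  filter_upwards [h] with u hu x using hu x trivial

/-- A central sequence is asymptotically central uniformly along compact orbits. -/
theorem StronglyContinuous.eventually_forall_commutator_le (hα : StronglyContinuous α)
    {x : ℕ → A} {M : ℝ} (hM : ∀ n, ‖x n‖ ≤ M)
    (hx : ∀ a : A, Tendsto (fun n => ‖x n * a - a * x n‖) atTop (𝓝 0)) (a : A) {ε : ℝ}
    (hε : 0 < ε) : ∀ᶠ n in atTop, ∀ g : G, ‖α g (x n) * a - a * α g (x n)‖ ≤ ε := by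
  have hM0 : 0 ≤ M := (norm_nonneg _).trans (hM 0)
  set η := ε / (4 * (M + 1)) with hη
  have hη0 : 0 < η := by positivity
  have hcov : ∀ g : G, {h : G | ‖α h⁻¹ a - α g⁻¹ a‖ < η} ∈ 𝓝 g := fun g => by
    have hc : Continuous fun h : G => ‖α h⁻¹ a - α g⁻¹ a‖ :=
      (((hα a).comp continuous_inv).sub continuous_const).norm
    exact hc.continuousAt.eventually_lt_const (by simpa using hη0)
  obtain ⟨t, -, ht⟩ := (isCompact_univ (X := G)).elim_nhds_subcover _ fun g _ => hcov g
  have hev : ∀ᶠ n in atTop, ∀ g ∈ t, ‖x n * α g⁻¹ a - α g⁻¹ a * x n‖ < ε / 2 :=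
    (Finset.eventually_all t).2 fun g _ => (hx (α g⁻¹ a)).eventually_lt_const (by positivity)
  filter_upwards [hev] with n hn h
  obtain ⟨g, hg, hgh⟩ := Set.mem_iUnion₂.1 (ht (Set.mem_univ h))
  have hgh' : ‖α h⁻¹ a - α g⁻¹ a‖ < η := hgh
  have hinv : α h (α h⁻¹ a) = a := by rw [← action_mul_apply]; simp
  -- Pulling the commutator back by `α h` moves the group variable onto `a`, whose orbit is compact
  -- and is covered by finitely many `η`-balls.
  have e1 : α h (x n) * a - a * α h (x n) = α h (x n * α h⁻¹ a - α h⁻¹ a * x n) := by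
    rw [map_sub, map_mul, map_mul, hinv]
  rw [e1, norm_action_apply]
  have e2 : x n * α h⁻¹ a - α h⁻¹ a * x n = (x n * α g⁻¹ a - α g⁻¹ a * x n) +
      (x n * (α h⁻¹ a - α g⁻¹ a) - (α h⁻¹ a - α g⁻¹ a) * x n) := by noncomm_ring
  rw [e2]
  have b1 : ‖x n * (α h⁻¹ a - α g⁻¹ a)‖ ≤ M * η :=
    (norm_mul_le _ _).trans (mul_le_mul (hM n) hgh'.le (norm_nonneg _) hM0)
  have b2 : ‖(α h⁻¹ a - α g⁻¹ a) * x n‖ ≤ M * η := by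
    refine (norm_mul_le _ _).trans ?_
    rw [mul_comm]
    exact mul_le_mul (hM n) hgh'.le (norm_nonneg _) hM0
  have b3 : 2 * (M * η) ≤ ε / 2 := by
    have : (M + 1) * η = ε / 4 := by rw [hη]; field_simp
    nlinarith
  calc _ ≤ ε / 2 + (M * η + M * η) :=
        (norm_add_le _ _).trans (add_le_add (hn g hg).le
          ((norm_sub_le _ _).trans (add_le_add b1 b2)))
    _ ≤ ε := by linarith

/-- Pointwise asymptotic invariance of a sequence with continuous orbit map is uniform over `G`. -/
theorem eventually_forall_norm_action_sub_le {G : Type*} [Group G] [TopologicalSpace G]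
    [CompactSpace G] {A : Type*} [CStarAlgebra A] {α : G →* (A ≃⋆ₐ[ℂ] A)} {Y : EllInfty A} (hY : Y ∈ ellContinuous α) {M δ : ℝ}
    (hδ : 0 < δ) (hM : ∀ g : G, ∀ᶠ n in atTop, ‖α g (Y n) - Y n‖ ≤ M) :
    ∀ᶠ n in atTop, ∀ g : G, ‖α g (Y n) - Y n‖ ≤ M + δ := by
  have hY' : Continuous fun g => ellAction α g Y := hY
  -- Continuity for the sup norm is equicontinuity in `n`, so one finite cover serves all terms of
  -- the sequence.
  have hcov : ∀ g : G, {h : G | ‖ellAction α h Y - ellAction α g Y‖ < δ} ∈ 𝓝 g := fun g =>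
    (hY'.sub continuous_const).norm.continuousAt.eventually_lt_const (by simpa using hδ)
  obtain ⟨t, -, ht⟩ := (isCompact_univ (X := G)).elim_nhds_subcover _ fun g _ => hcov g
  have hev : ∀ᶠ n in atTop, ∀ g ∈ t, ‖α g (Y n) - Y n‖ ≤ M :=
    (Finset.eventually_all t).2 fun g _ => hM g
  filter_upwards [hev] with n hn h
  obtain ⟨g, hg, hgh⟩ := Set.mem_iUnion₂.1 (ht (Set.mem_univ h))
  have hgh' : ‖ellAction α h Y - ellAction α g Y‖ < δ := hgh
  have h1 : ‖α h (Y n) - α g (Y n)‖ ≤ δ :=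
    ((ellAction α h Y - ellAction α g Y).norm_coe_le_norm n).trans hgh'.le
  calc ‖α h (Y n) - Y n‖ = ‖(α g (Y n) - Y n) + (α h (Y n) - α g (Y n))‖ := by congr 1; abel
    _ ≤ M + δ := (norm_add_le _ _).trans (add_le_add (hn g hg) h1)

end CompactGroups

/-! ### The quotient map onto the sequence algebra. -/

theorem isClosed_cZero (A : Type*) [CStarAlgebra A] : IsClosed (cZero A : Set (EllInfty A)) := by
  refine isClosed_of_closure_subset fun x hx => ?_
  refine mem_cZero.2 (Metric.tendsto_atTop.2 fun ε hε => ?_)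
  obtain ⟨y, hy, hxy⟩ := Metric.mem_closure_iff.1 hx (ε / 2) (by positivity)
  obtain ⟨N, hN⟩ := Metric.tendsto_atTop.1 (mem_cZero.1 hy) (ε / 2) (by positivity)
  refine ⟨N, fun n hn => ?_⟩
  have h1 := hN n hn
  have h2 : ‖x n - y n‖ < ε / 2 := by
    rw [dist_eq_norm] at hxy
    exact ((x - y).norm_coe_le_norm n).trans_lt hxy
  simp only [dist_zero_right, norm_norm] at h1 ⊢
  calc ‖x n‖ = ‖(x n - y n) + y n‖ := by rw [sub_add_cancel]
    _ < ε := (norm_add_le _ _).trans_lt (by linarith)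

theorem proj_eq_zero_iff {A : Type*} [CStarAlgebra A] {x : EllInfty A} :
    proj A x = 0 ↔ x ∈ cZero A := Ideal.Quotient.eq_zero_iff_mem

theorem proj_surjective (A : Type*) [CStarAlgebra A] : Function.Surjective (proj A) :=
  Ideal.Quotient.mk_surjective

theorem eventually_norm_le_of_mem_cZero {A : Type*} [CStarAlgebra A] {x : EllInfty A}
    (hx : x ∈ cZero A) {ε : ℝ} (hε : 0 < ε) : ∀ᶠ n in atTop, ‖x n‖ ≤ ε :=
  (mem_cZero.1 hx).eventually_le_const hε

theorem norm_one_le_one (A : Type*) [CStarAlgebra A] : ‖(1 : A)‖ ≤ 1 := by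
  obtain (h | h) := subsingleton_or_nontrivial A
  · simp [Subsingleton.elim (1 : A) 0]
  · exact CStarRing.norm_one.le

theorem eventually_norm_le_of_proj_eq_one {A : Type*} [CStarAlgebra A] {x : EllInfty A}
    (hx : proj A x = 1) : ∀ᶠ n in atTop, ‖x n‖ ≤ 5 / 4 := by
  have h : x - 1 ∈ cZero A := by rw [← proj_eq_zero_iff, map_sub, map_one, hx, sub_self]
  filter_upwards [eventually_norm_le_of_mem_cZero h (ε := 1 / 4) (by norm_num)] with n hn
  have h1 : ‖x n - 1‖ ≤ 1 / 4 := hn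
  calc ‖x n‖ = ‖(x n - 1) + 1‖ := by rw [sub_add_cancel]
    _ ≤ 1 / 4 + 1 := (norm_add_le _ _).trans (add_le_add h1 (norm_one_le_one A))
    _ = 5 / 4 := by norm_num

theorem constSeq_apply {A : Type*} [CStarAlgebra A] (a : A) (n : ℕ) : constSeq A a n = a := rfl

/-! ### Elementary tensors in `A_∞` and the basic error estimate. -/

section MulIota

variable {X : Type*} [TopologicalSpace X] {A : Type*} [CStarAlgebra A]

/-- The image of the elementary tensor `f ⊗ a` under the map `C(X) ⊗ A → A_∞` induced by `θ`. -/
def mulIota (θ : C(X, ℂ) →⋆ₐ[ℂ] AInfty A) (f : C(X, ℂ)) (a : A) : AInfty A := θ f * iota A a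

variable {θ : C(X, ℂ) →⋆ₐ[ℂ] AInfty A}

theorem mulIota_mul (hθ : ∀ f a, Commute (θ f) (iota A a)) (f g : C(X, ℂ)) (a b : A) :
    mulIota θ f a * mulIota θ g b = mulIota θ (f * g) (a * b) := by
  simp only [mulIota, map_mul]
  rw [mul_assoc, ← mul_assoc (iota A a), ← (hθ g a).eq]
  simp only [mul_assoc]

theorem mul_iota_mul (hθ : ∀ f a, Commute (θ f) (iota A a)) (f g : C(X, ℂ)) (a : A) :
    θ f * iota A a * θ g = mulIota θ (f * g) a := by
  rw [mulIota, mul_assoc, ← (hθ g a).eq, map_mul, mul_assoc]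

theorem mulIota_one_left (a : A) : mulIota θ 1 a = iota A a := by simp [mulIota]

theorem mulIota_zero_left (a : A) : mulIota θ 0 a = 0 := by simp [mulIota]

theorem mulIota_sub_right (f : C(X, ℂ)) (a b : A) :
    mulIota θ f (a - b) = mulIota θ f a - mulIota θ f b := by simp [mulIota, mul_sub]

theorem mulIota_eq_sum {P : Type*} [Fintype P] {k : P → C(X, ℂ)} (hk : ∑ p, k p = 1)
    (f : C(X, ℂ)) (a : A) : mulIota θ f a = ∑ p, mulIota θ (k p * f) a := by
  simp only [mulIota]
  rw [← Finset.sum_mul, ← map_sum, ← Finset.sum_mul, hk, one_mul]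

/-- Since `θ` commutes with `A`, the sum lifts to `∑ T_p⋆ c_p T_p`, a sum of conjugates with weights
eventually of norm at most `5/4`. The lifting error `δ/2` and the bound `2 · δ · 5/4` add up to
`3δ`. -/
theorem eventually_norm_le_of_proj_eq_sum [CompactSpace X] (hθ : ∀ f a, Commute (θ f) (iota A a))
    {P : Type*} [Fintype P] {F : P → C(X, ℂ)} (hF : ∑ p, star (F p) * F p = 1) {c : P → A} {δ : ℝ}
    (hδ : 0 < δ) (hc : ∀ p, F p ≠ 0 → ‖c p‖ ≤ δ) {Z : EllInfty A}
    (hZ : proj A Z = ∑ p, mulIota θ (star (F p) * F p) (c p)) :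
    ∀ᶠ n in atTop, ‖Z n‖ ≤ 3 * δ := by
  classical
  choose T hT using fun p => proj_surjective A (θ (F p))
  -- Coefficients with vanishing weight are uncontrolled, but replacing them by zero does not change
  -- the class in `A_∞`.
  set d : P → A := fun p => if F p = 0 then 0 else c p with hd
  have hdδ : ∀ p ∈ Finset.univ, ‖d p‖ ≤ δ := fun p _ => by
    by_cases hp : F p = 0
    · simp [hd, hp, hδ.le]
    · simpa [hd, hp] using hc p hp
  set W : EllInfty A := ∑ p, star (T p) * constSeq A (d p) * T p with hW
  have hZW : Z - W ∈ cZero A := by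
    rw [← proj_eq_zero_iff, map_sub, hZ, hW, map_sum, sub_eq_zero]
    refine Finset.sum_congr rfl fun p _ => ?_
    rw [map_mul, map_mul, map_star, hT, ← map_star,
      show proj A (constSeq A (d p)) = iota A (d p) from rfl, mul_iota_mul hθ]
    by_cases hp : F p = 0
    · simp [hp, mulIota_zero_left]
    · simp [hd, hp]
  have hone : proj A (∑ p, star (T p) * T p) = 1 := by
    simp only [map_sum, map_mul, map_star, hT]
    rw [← map_one θ, ← hF, map_sum]
    simp only [map_mul, map_star]
  filter_upwards [eventually_norm_le_of_mem_cZero hZW (half_pos hδ),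
    eventually_norm_le_of_proj_eq_one hone] with n h1 h2
  have h1' : ‖Z n - W n‖ ≤ δ / 2 := h1
  have hWn : W n = ∑ p, star (T p n) * d p * T p n := by
    simp [hW, constSeq_apply]
  have h2' : ‖∑ p, star (T p n) * T p n‖ ≤ 5 / 4 := by simpa using h2
  have h3 : ‖W n‖ ≤ 2 * δ * (5 / 4) := by
    rw [hWn]
    exact (norm_sum_star_mul_mul_le _ (fun p => T p n) d hδ.le hdδ).trans
      (mul_le_mul_of_nonneg_left h2' (by positivity))
  calc ‖Z n‖ = ‖(Z n - W n) + W n‖ := by rw [sub_add_cancel]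
    _ ≤ δ / 2 + 2 * δ * (5 / 4) := (norm_add_le _ _).trans (add_le_add h1' h3)
    _ = 3 * δ := by ring

theorem sum_star_mul_self_prod {ι : Type*} [Fintype ι] {f f' : ι → C(X, ℂ)} (hf : ∀ i, star (f i) = f i)
    (h1 : ∑ i, f i * f i = 1) (hf' : ∀ i, star (f' i) = f' i) (h1' : ∑ i, f' i * f' i = 1) :
    ∑ p : ι × ι, star (f p.1 * f' p.2) * (f p.1 * f' p.2) = 1 := by
  rw [Fintype.sum_prod_type, ← one_mul (1 : C(X, ℂ))]
  nth_rw 1 [← h1]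
  rw [← h1', Finset.sum_mul_sum]
  refine Finset.sum_congr rfl fun i _ => Finset.sum_congr rfl fun j _ => ?_
  rw [star_mul, hf, hf']
  ring

theorem proj_sum_star_mul_self {ι : Type*} [Fintype ι] {f : ι → C(X, ℂ)}
    {T : ι → EllInfty A} (hf : ∀ i, star (f i) = f i) (h1 : ∑ i, f i * f i = 1)
    (hT : ∀ i, proj A (T i) = θ (f i)) : proj A (∑ i, star (T i) * T i) = 1 := by
  simp only [map_sum, map_mul, map_star, hT]
  rw [← map_one θ, ← h1, map_sum]
  simp [← map_star, hf]

end MulIota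

/-! ### Discretised orbit functions. -/

section TranslateSum

variable {G : Type*} [Group G] {A : Type*} [CStarAlgebra A] {ι : Type*} [Fintype ι]

/-- The map `c ↦ ∑ i, sᵢ⋆ α_{xᵢ}(c) sᵢ`. -/
def translateMap (α : G →* (A ≃⋆ₐ[ℂ] A)) (s : ι → A) (x : ι → G) : A →ₗ[ℂ] A where
  toFun c := ∑ i, star (s i) * α (x i) c * s i
  map_add' a b := by simp [mul_add, add_mul, Finset.sum_add_distrib]
  map_smul' c a := by simp [Finset.smul_sum]

theorem translateMap_apply (α : G →* (A ≃⋆ₐ[ℂ] A)) (s : ι → A) (x : ι → G) (c : A) :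
    translateMap α s x c = ∑ i, star (s i) * α (x i) c * s i := rfl

theorem translateMap_star (α : G →* (A ≃⋆ₐ[ℂ] A)) (s : ι → A) (x : ι → G) (c : A) :
    translateMap α s x (star c) = star (translateMap α s x c) := by
  simp [translateMap_apply, mul_assoc, map_star]

theorem norm_translateMap_le (α : G →* (A ≃⋆ₐ[ℂ] A)) {s : ι → A}
    (hs : ‖∑ i, star (s i) * s i‖ ≤ 5 / 4) (x : ι → G) (c : A) :
    ‖translateMap α s x c‖ ≤ 4 * ‖c‖ := by
  refine (norm_sum_star_mul_mul_le _ s _ (norm_nonneg c)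
    fun i _ => (norm_action_apply α (x i) c).le).trans ?_
  nlinarith [norm_nonneg c]

/-- The sequence obtained by applying `translateMap` to the terms of the sequences `T i`. -/
def translateSum (α : G →* (A ≃⋆ₐ[ℂ] A)) (T : ι → EllInfty A) (x : ι → G) (c : A) : EllInfty A :=
  ∑ i, star (T i) * constSeq A (α (x i) c) * T i

theorem translateSum_apply (α : G →* (A ≃⋆ₐ[ℂ] A)) (T : ι → EllInfty A) (x : ι → G) (c : A)
    (n : ℕ) : translateSum α T x c n = translateMap α (fun i => T i n) x c := by
  simp [translateSum, translateMap_apply, constSeq_apply]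

variable [TopologicalSpace G] {α : G →* (A ≃⋆ₐ[ℂ] A)}

theorem constSeq_mem_ellContinuous (hα : StronglyContinuous α) (a : A) :
    constSeq A a ∈ ellContinuous α := by
  have h : Isometry (constSeq A) := AddMonoidHomClass.isometry_of_norm _ fun a =>
    norm_const_eq a
  exact h.continuous.comp (hα a)

theorem translateSum_mem_ellContinuous (hα : StronglyContinuous α) {T : ι → EllInfty A}
    (hT : ∀ i, T i ∈ ellContinuous α) (x : ι → G) (c : A) :
    translateSum α T x c ∈ ellContinuous α :=
  sum_mem fun i _ => mul_mem (mul_mem (star_mem (hT i)) (constSeq_mem_ellContinuous hα _)) (hT i)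

variable {θ : C(G, ℂ) →⋆ₐ[ℂ] AInfty A}

theorem inftyAction_mulIota [IsTopologicalGroup G]
    (hequiv : ∀ g f, inftyAction α g (θ f) = θ (f.comp (ContinuousMap.mulLeft g⁻¹)))
    (g : G) (f : C(G, ℂ)) (a : A) :
    inftyAction α g (mulIota θ f a) =
      mulIota θ (f.comp (ContinuousMap.mulLeft g⁻¹)) (α g a) := by
  rw [mulIota, mulIota, map_mul, hequiv]
  rfl

variable {f : ι → C(G, ℂ)} {T : ι → EllInfty A} {x : ι → G}

theorem proj_translateSum (hθ : ∀ f a, Commute (θ f) (iota A a)) (hf : ∀ i, star (f i) = f i)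
    (hT : ∀ i, proj A (T i) = θ (f i)) (x : ι → G) (c : A) :
    proj A (translateSum α T x c) = ∑ i, mulIota θ (f i * f i) (α (x i) c) := by
  rw [translateSum, map_sum]
  refine Finset.sum_congr rfl fun i _ => ?_
  rw [map_mul, map_mul, map_star, hT, ← map_star, hf, ← mul_iota_mul hθ]
  rfl

theorem eventually_translateMap_one_sub_one_le (hθ : ∀ f a, Commute (θ f) (iota A a))
    (hf : ∀ i, star (f i) = f i) (h1 : ∑ i, f i * f i = 1) (hT : ∀ i, proj A (T i) = θ (f i))
    {δ : ℝ} (hδ : 0 < δ) :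
    ∀ᶠ n in atTop, ‖translateMap α (fun i => T i n) x 1 - 1‖ ≤ δ := by
  have h : translateSum α T x 1 - 1 ∈ cZero A := by
    rw [← proj_eq_zero_iff, map_sub, proj_translateSum hθ hf hT]
    simp only [map_one, mulIota, mul_one]
    rw [← map_sum, h1, map_one, sub_self]
  filter_upwards [eventually_norm_le_of_mem_cZero h hδ] with n hn
  rw [← translateSum_apply]
  exact hn

variable [CompactSpace G]

theorem eventually_translateMap_commutator_le (hθ : ∀ f a, Commute (θ f) (iota A a))
    (hf : ∀ i, star (f i) = f i) (h1 : ∑ i, f i * f i = 1) (hT : ∀ i, proj A (T i) = θ (f i))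
    {a c : A} {δ : ℝ} (hδ : 0 < δ) (hc : ∀ i, ‖α (x i) c * a - a * α (x i) c‖ ≤ δ) :
    ∀ᶠ n in atTop, ‖translateMap α (fun i => T i n) x c * a -
      a * translateMap α (fun i => T i n) x c‖ ≤ 3 * δ := by
  have := eventually_norm_le_of_proj_eq_sum hθ (F := f) (by simpa only [hf] using h1)
    (c := fun i => α (x i) c * a - a * α (x i) c) hδ (fun i _ => hc i)
    (Z := translateSum α T x c * constSeq A a - constSeq A a * translateSum α T x c) (by
      rw [map_sub, map_mul, map_mul, proj_translateSum hθ hf hT,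
        show proj A (constSeq A a) = iota A a from rfl, ← mulIota_one_left (θ := θ) a,
        Finset.sum_mul, Finset.mul_sum, ← Finset.sum_sub_distrib]
      refine Finset.sum_congr rfl fun i _ => ?_
      rw [mulIota_mul hθ, mulIota_mul hθ, mul_one, one_mul, hf, mulIota_sub_right])
  filter_upwards [this] with n hn
  rw [← translateSum_apply]
  exact hn

/-- On the common refinement with weights `f_i² f_j²`, the defect has coefficients `α_{x_i}(b)
(α_{x_i}(c) - α_{x_j}(c))`, relevant only where the supports of `f_i` and `f_j` meet. -/
theorem eventually_translateMap_mul_sub_le (hθ : ∀ f a, Commute (θ f) (iota A a))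
    (hf : ∀ i, star (f i) = f i) (h1 : ∑ i, f i * f i = 1) (hT : ∀ i, proj A (T i) = θ (f i))
    {b c : A} {δ : ℝ} (hδ : 0 < δ)
    (hc : ∀ i j, f i * f j ≠ 0 → ‖α (x i) b * (α (x i) c - α (x j) c)‖ ≤ δ) :
    ∀ᶠ n in atTop, ‖translateMap α (fun i => T i n) x (b * c) -
      translateMap α (fun i => T i n) x b * translateMap α (fun i => T i n) x c‖ ≤ 3 * δ := by
  have := eventually_norm_le_of_proj_eq_sum hθ (F := fun p : ι × ι => f p.1 * f p.2)
    (sum_star_mul_self_prod hf h1 hf h1)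
    (c := fun p => α (x p.1) b * (α (x p.1) c - α (x p.2) c)) hδ (fun p => hc p.1 p.2)
    (Z := translateSum α T x (b * c) - translateSum α T x b * translateSum α T x c) (by
      rw [map_sub, map_mul, proj_translateSum hθ hf hT, proj_translateSum hθ hf hT,
        proj_translateSum hθ hf hT, Finset.sum_mul_sum, Fintype.sum_prod_type,
        ← Finset.sum_sub_distrib]
      refine Finset.sum_congr rfl fun i _ => ?_
      rw [mulIota_eq_sum h1, ← Finset.sum_sub_distrib]
      refine Finset.sum_congr rfl fun j _ => ?_
      rw [mulIota_mul hθ, mul_sub, mulIota_sub_right, map_mul, star_mul, hf, hf]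
      congr 2 <;> ring)
  filter_upwards [this] with n hn
  simp only [← translateSum_apply]
  exact hn

/-- Acting by `g` translates the partition and replaces `x_i` by `g x_i`. Comparison with the
original sum takes place on the common refinement of the two partitions. -/
theorem eventually_action_translateMap_sub_le [IsTopologicalGroup G]
    (hθ : ∀ f a, Commute (θ f) (iota A a))
    (hequiv : ∀ g f, inftyAction α g (θ f) = θ (f.comp (ContinuousMap.mulLeft g⁻¹)))
    (hf : ∀ i, star (f i) = f i) (h1 : ∑ i, f i * f i = 1) (hT : ∀ i, proj A (T i) = θ (f i))
    (g : G) {c : A} {δ : ℝ} (hδ : 0 < δ)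
    (hc : ∀ i j, (f i).comp (ContinuousMap.mulLeft g⁻¹) * f j ≠ 0 →
      ‖α (g * x i) c - α (x j) c‖ ≤ δ) :
    ∀ᶠ n in atTop, ‖α g (translateSum α T x c n) - translateSum α T x c n‖ ≤ 3 * δ := by
  set f' : ι → C(G, ℂ) := fun i => (f i).comp (ContinuousMap.mulLeft g⁻¹) with hf'
  have hf's : ∀ i, star (f' i) = f' i := fun i => by
    ext y
    exact DFunLike.congr_fun (hf i) (g⁻¹ * y)
  have h1' : ∑ i, f' i * f' i = 1 := by
    ext y
    simpa [hf'] using DFunLike.congr_fun h1 (g⁻¹ * y)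
  refine eventually_norm_le_of_proj_eq_sum hθ (F := fun p : ι × ι => f' p.1 * f p.2)
    (sum_star_mul_self_prod hf's h1' hf h1)
    (c := fun p => α (g * x p.1) c - α (x p.2) c) hδ (fun p => hc p.1 p.2)
    (Z := ellAction α g (translateSum α T x c) - translateSum α T x c) ?_
  have e1 : proj A (ellAction α g (translateSum α T x c)) =
      ∑ i, mulIota θ (f' i * f' i) (α (g * x i) c) := by
    have h : proj A (ellAction α g (translateSum α T x c)) =
      inftyAction α g (proj A (translateSum α T x c)) := rfl
    rw [h, proj_translateSum hθ hf hT, map_sum]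
    refine Finset.sum_congr rfl fun i _ => ?_
    rw [inftyAction_mulIota hequiv, ← action_mul_apply]
    rfl
  rw [map_sub, e1, proj_translateSum hθ hf hT]
  simp only [mulIota_sub_right, Finset.sum_sub_distrib]
  congr 1
  · rw [Fintype.sum_prod_type]
    refine Finset.sum_congr rfl fun i _ => ?_
    rw [mulIota_eq_sum h1]
    refine Finset.sum_congr rfl fun j _ => ?_
    rw [star_mul, hf, hf's]
    congr 1
    ring
  · rw [Fintype.sum_prod_type_right]
    refine Finset.sum_congr rfl fun j _ => ?_
    rw [mulIota_eq_sum h1']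
    refine Finset.sum_congr rfl fun i _ => ?_
    rw [star_mul, hf, hf's]
    congr 1
    ring

/-- Averaging the elements built from the translates of `c` by the `x l⁻¹` recovers `c`, hence one
of them is large. -/
theorem eventually_exists_norm_le_translateMap [Nonempty ι]
    (hθ : ∀ f a, Commute (θ f) (iota A a))
    (hf : ∀ i, star (f i) = f i) (h1 : ∑ i, f i * f i = 1) (hT : ∀ i, proj A (T i) = θ (f i))
    {c : A} {ε : ℝ} (hε : 0 < ε)
    (hc : ∀ l i, f l * f i ≠ 0 → ‖c - α (x i * (x l)⁻¹) c‖ ≤ ε / 6) :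
    ∀ᶠ n in atTop, ∃ l,
      ‖c‖ ≤ 4 * ‖translateMap α (fun i => T i n) (fun i => x i * (x l)⁻¹) c‖ + ε := by
  set V : ι → EllInfty A := fun l => translateSum α T (fun i => x i * (x l)⁻¹) c with hV
  have key := eventually_norm_le_of_proj_eq_sum hθ (F := fun p : ι × ι => f p.1 * f p.2)
    (sum_star_mul_self_prod hf h1 hf h1)
    (c := fun p => c - α (x p.2 * (x p.1)⁻¹) c) (δ := ε / 6) (by positivity)
    (fun p => hc p.1 p.2) (Z := constSeq A c - ∑ l, star (T l) * V l * T l) (by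
      rw [map_sub, show proj A (constSeq A c) = iota A c from rfl]
      simp only [mulIota_sub_right, Finset.sum_sub_distrib]
      congr 1
      · rw [← mulIota_one_left (θ := θ), mulIota_eq_sum (sum_star_mul_self_prod hf h1 hf h1)]
        simp only [mul_one]
      · rw [map_sum, Fintype.sum_prod_type]
        refine Finset.sum_congr rfl fun l _ => ?_
        rw [map_mul, map_mul, map_star, hT, ← map_star, hf, hV, proj_translateSum hθ hf hT,
          Finset.mul_sum, Finset.sum_mul]
        refine Finset.sum_congr rfl fun i _ => ?_
        rw [mulIota, ← mul_assoc, ← map_mul, mul_iota_mul hθ, star_mul, hf, hf]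
        congr 1
        ring)
  filter_upwards [key,
    eventually_norm_le_of_proj_eq_one (proj_sum_star_mul_self hf h1 hT)] with n hn hn1
  -- If every `V l n` were small, the average would have norm at most `2 · (5/4) · (‖c‖ - ε)/4 =
  -- (5/8)(‖c‖ - ε)`, yet it lies within `ε/2` of `c`. These are incompatible.
  by_contra! hlt
  have hlt' : ∀ l ∈ Finset.univ, ‖V l n‖ ≤ (‖c‖ - ε) / 4 := fun l _ => by
    have := hlt l
    rw [hV, translateSum_apply]
    linarith
  have hpos : 0 ≤ (‖c‖ - ε) / 4 :=
    (norm_nonneg _).trans (hlt' (Classical.arbitrary ι) (Finset.mem_univ _))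
  have h2 : ‖∑ p, star (T p n) * T p n‖ ≤ 5 / 4 := by simpa using hn1
  have h3 := (norm_sum_star_mul_mul_le Finset.univ (fun l => T l n) (fun l => V l n) hpos hlt').trans
    (mul_le_mul_of_nonneg_left h2 (by positivity))
  have hn' : ‖c - ∑ l, star (T l n) * V l n * T l n‖ ≤ 3 * (ε / 6) := by
    simpa [constSeq_apply] using hn
  have h4 : ‖c‖ ≤ ‖c - ∑ l, star (T l n) * V l n * T l n‖ +
      ‖∑ l, star (T l n) * V l n * T l n‖ := by
    simpa using norm_add_le (c - ∑ l, star (T l n) * V l n * T l n)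
      (∑ l, star (T l n) * V l n * T l n)
  linarith

end TranslateSum

/-! ### Approximate embeddings obtained from the Rokhlin property. -/

section RokhlinApproximation

/-- Both `p` and `q` are close to the common point `p u = q v`; the left factors act isometrically.
Uniformity over the orbit of `c` absorbs the factor `x` on the right. -/
theorem norm_action_sub_action_le {G : Type*} [Group G] {A : Type*} [CStarAlgebra A]
    {α : G →* (A ≃⋆ₐ[ℂ] A)} {U : Set G} {c : A} {δ : ℝ}
    (hU : ∀ u ∈ U, ∀ x : G, ‖α u (α x c) - α x c‖ < δ / 2) {p q u v : G} (hu : u ∈ U) (hv : v ∈ U)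
    (h : p * u = q * v) (x : G) : ‖α (p * x) c - α (q * x) c‖ ≤ δ := by
  have h1 : ‖α (p * u * x) c - α (p * x) c‖ < δ / 2 := by
    rw [mul_assoc, action_mul_apply, action_mul_apply α p x, action_mul_apply, ← map_sub,
      norm_action_apply]
    exact hU u hu x
  have h2 : ‖α (q * v * x) c - α (q * x) c‖ < δ / 2 := by
    rw [mul_assoc, action_mul_apply, action_mul_apply α q x, action_mul_apply, ← map_sub,
      norm_action_apply]
    exact hU v hv x
  rw [h, norm_sub_rev] at h1
  calc ‖α (p * x) c - α (q * x) c‖ =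
        ‖(α (p * x) c - α (q * v * x) c) + (α (q * v * x) c - α (q * x) c)‖ := by congr 1; abel
    _ ≤ δ := (norm_add_le _ _).trans (by linarith)

variable {A : Type*} [CStarAlgebra A] {G : Type*} [Group G] [TopologicalSpace G]
  [IsTopologicalGroup G] {α : G →* (A ≃⋆ₐ[ℂ] A)}

/-- The Rokhlin property in terms of a homomorphism into the whole sequence algebra. -/
theorem HasRokhlinProperty.exists_starAlgHom (h : HasRokhlinProperty α) :
    ∃ θ : C(G, ℂ) →⋆ₐ[ℂ] AInfty A, (∀ f, θ f ∈ inftyContinuous α) ∧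
      (∀ f a, Commute (θ f) (iota A a)) ∧
      ∀ g f, inftyAction α g (θ f) = θ (f.comp (ContinuousMap.mulLeft g⁻¹)) := by
  obtain ⟨θ, -, hθ⟩ := h
  refine ⟨(StarSubalgebra.subtype _).comp θ, fun f => (θ f).2.1, fun f a => ?_, fun g f => hθ g f⟩
  have := (StarSubalgebra.mem_centralizer_iff ℂ).1 (θ f).2.2 (iota A a) ⟨a, rfl⟩
  exact this.1.symm

variable [CompactSpace G] [T2Space G] {B : Type*} [CStarAlgebra B]

/-- Approximately multiplicative, central and invariant maps `B → A`, up to finitely many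
conditions. -/
theorem exists_linearMap_approx (hα : StronglyContinuous α) (hRok : HasRokhlinProperty α)
    (hB : AdmitsCentralSequence B A) (F : Finset B) (H : Finset A) {ε : ℝ} (hε : 0 < ε) (b₀ : B) :
    ∃ φ : B →ₗ[ℂ] A, (∀ b, φ (star b) = star (φ b)) ∧ (∀ b, ‖φ b‖ ≤ 4 * ‖b‖) ∧
      ‖φ 1 - 1‖ ≤ ε ∧ (∀ b ∈ F, ∀ c ∈ F, ‖φ (b * c) - φ b * φ c‖ ≤ ε) ∧
      (∀ b ∈ F, ∀ a ∈ H, ‖φ b * a - a * φ b‖ ≤ ε) ∧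
      (∀ b ∈ F, ∀ g, ‖α g (φ b) - φ b‖ ≤ ε) ∧ ‖b₀‖ ≤ 4 * ‖φ b₀‖ + ε := by
  classical
  obtain ⟨ψ, hψ, hψc⟩ := hB
  obtain ⟨θ, hθc, hθ, hequiv⟩ := hRok.exists_starAlgHom
  have hψn : ∀ n b, ‖ψ n b‖ = ‖b‖ := fun n b => NonUnitalStarAlgHom.norm_map (ψ n) (hψ n) b
  obtain ⟨n, hn⟩ : ∃ n, ∀ b ∈ F, ∀ a ∈ H, ∀ g : G,
      ‖α g (ψ n b) * a - a * α g (ψ n b)‖ ≤ ε / 3 :=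
    ((Finset.eventually_all F).2 fun b _ => (Finset.eventually_all H).2 fun a _ =>
      hα.eventually_forall_commutator_le (fun n => (hψn n b).le) (hψc b) a (by positivity)).exists
  set ρ := ψ n
  set C : ℝ := ∑ b ∈ F, ‖b‖
  have hC0 : 0 ≤ C := Finset.sum_nonneg fun b _ => norm_nonneg b
  have hC : ∀ b ∈ F, ‖b‖ ≤ C := fun b hb =>
    Finset.single_le_sum (f := fun b => ‖b‖) (fun b _ => norm_nonneg b) hb
  -- Small enough that `3δ + ε/2 ≤ ε` for invariance and that `C δ` is within the tolerance `ε/3`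
  -- for multiplicativity.
  set δ : ℝ := ε / (6 * (C + 1)) with hδ
  have hδ0 : 0 < δ := by positivity
  have hδε : δ ≤ ε / 6 := by
    rw [hδ]
    gcongr
    linarith
  have hCδ : C * δ ≤ ε / 6 := by
    have : (C + 1) * δ = ε / 6 := by rw [hδ]; field_simp
    nlinarith
  have hU : ∀ᶠ u in 𝓝 (1 : G), ∀ b ∈ insert b₀ F, ∀ x : G,
      ‖α u (α x (ρ b)) - α x (ρ b)‖ < δ / 2 :=
    (Finset.eventually_all _).2 fun b _ =>
      hα.eventually_forall_norm_sub_lt (ρ b) (by positivity)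
  obtain ⟨t, f, hf, h1, hfU⟩ := exists_sq_partition_subordinate_translates hU
  choose T hTc hT using fun i => hθc (f i)
  have hclose : ∀ b ∈ insert b₀ F, ∀ (g : G) (i j : t) (h : G),
      (f i).comp (ContinuousMap.mulLeft g⁻¹) * f j ≠ 0 →
        ‖α (g * (i * h)) (ρ b) - α (j * h) (ρ b)‖ ≤ δ := by
    intro b hb g i j h hne
    -- At a common point `y` of the supports, `y = (g i) u = j v` with `u` and `v` both in the
    -- neighbourhood.
    obtain ⟨y, hy⟩ := DFunLike.ne_iff.1 hne
    have hy' : f i (g⁻¹ * y) * f j y ≠ 0 := hy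
    rw [← mul_assoc]
    exact norm_action_sub_action_le (U := {u | ∀ b ∈ insert b₀ F, ∀ x : G,
      ‖α u (α x (ρ b)) - α x (ρ b)‖ < δ / 2}) (fun u hu x => hu b hb x)
      (hfU i _ (left_ne_zero_of_mul hy')) (hfU j _ (right_ne_zero_of_mul hy')) (by group) h
  have hclose' : ∀ b ∈ insert b₀ F, ∀ (i j : t) (h : G), f i * f j ≠ 0 →
        ‖α (i * h) (ρ b) - α (j * h) (ρ b)‖ ≤ δ := by
    intro b hb i j h hne
    have := hclose b hb 1 i j h (by
      convert hne
      ext y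
      simp)
    rwa [one_mul] at this
  have hne : Nonempty t := by
    by_contra hemp
    rw [not_nonempty_iff] at hemp
    rw [Finset.univ_eq_empty, Finset.sum_empty] at h1
    exact zero_ne_one (DFunLike.congr_fun h1 (1 : G))
  -- Row `l` is the family of sample points based at `l⁻¹`. All estimates except the lower norm
  -- bound are arranged for every `l` at once, leaving `l` free to be chosen last.
  set x : t → t → G := fun l i => i * (l : G)⁻¹ with hx
  have hF : ∀ b ∈ F, b ∈ insert b₀ F := fun b hb => Finset.mem_insert_of_mem hb
  have ev1 := eventually_norm_le_of_proj_eq_one (proj_sum_star_mul_self hf h1 hT)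
  have ev2 : ∀ᶠ k in atTop, ∀ l, ‖translateMap α (fun i => T i k) (x l) 1 - 1‖ ≤ ε :=
    eventually_all.2 fun l => eventually_translateMap_one_sub_one_le hθ hf h1 hT hε
  have ev3 : ∀ᶠ k in atTop, ∀ l, ∀ b ∈ F, ∀ c ∈ F,
      ‖translateMap α (fun i => T i k) (x l) (ρ b * ρ c) -
        translateMap α (fun i => T i k) (x l) (ρ b) *
          translateMap α (fun i => T i k) (x l) (ρ c)‖ ≤ 3 * (ε / 3) :=
    eventually_all.2 fun l => (Finset.eventually_all F).2 fun b hb =>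
      (Finset.eventually_all F).2 fun c hc =>
        eventually_translateMap_mul_sub_le hθ hf h1 hT (by positivity) fun i j hij => by
          refine (norm_mul_le _ _).trans ?_
          rw [norm_action_apply, hψn]
          have := mul_le_mul (hC b hb) (hclose' c (hF c hc) i j (l : G)⁻¹ hij) (norm_nonneg _) hC0
          linarith
  have ev4 : ∀ᶠ k in atTop, ∀ l, ∀ b ∈ F, ∀ a ∈ H,
      ‖translateMap α (fun i => T i k) (x l) (ρ b) * a -
        a * translateMap α (fun i => T i k) (x l) (ρ b)‖ ≤ 3 * (ε / 3) :=
    eventually_all.2 fun l => (Finset.eventually_all F).2 fun b hb =>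
      (Finset.eventually_all H).2 fun a ha =>
        eventually_translateMap_commutator_le hθ hf h1 hT (by positivity) fun i => hn b hb a ha _
  have ev5 : ∀ᶠ k in atTop, ∀ l, ∀ b ∈ F, ∀ g : G,
      ‖α g (translateSum α T (x l) (ρ b) k) - translateSum α T (x l) (ρ b) k‖ ≤
        3 * δ + ε / 2 :=
    eventually_all.2 fun l => (Finset.eventually_all F).2 fun b hb =>
      eventually_forall_norm_action_sub_le (translateSum_mem_ellContinuous hα hTc _ _)
        (by positivity) fun g => eventually_action_translateMap_sub_le hθ hequiv hf h1 hT g hδ0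
          fun i j hij => hclose b (hF b hb) g i j (l : G)⁻¹ hij
  have ev6 := eventually_exists_norm_le_translateMap (α := α) (x := fun i : t => (i : G)) hθ hf h1 hT
    (c := ρ b₀) hε fun l i hli => by
      have := hclose' b₀ (Finset.mem_insert_self _ _) l i (l : G)⁻¹ hli
      rw [mul_inv_cancel, map_one] at this
      exact this.trans hδε
  obtain ⟨k, h1k, h2k, h3k, h4k, h5k, l, h6k⟩ :=
    (ev1.and (ev2.and (ev3.and (ev4.and (ev5.and ev6))))).exists
  refine ⟨(translateMap α (fun i => T i k) (x l)).comp (ρ : B →ₗ[ℂ] A), fun b => ?_, fun b => ?_,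
    ?_, fun b hb c hc => ?_, fun b hb a ha => ?_, fun b hb g => ?_, ?_⟩
  · simp [map_star, translateMap_star]
  · have := norm_translateMap_le α (s := fun i => T i k) (by simpa using h1k) (x l) (ρ b)
    rwa [hψn] at this
  · simpa using h2k l
  · have := h3k l b hb c hc
    rw [← map_mul] at this
    exact this.trans (by linarith)
  · exact (h4k l b hb a ha).trans (by linarith)
  · have := h5k l b hb g
    rw [translateSum_apply] at this
    exact this.trans (by linarith)
  · rw [hψn] at h6k
    exact h6k

end RokhlinApproximation

/-! ### Passage to the limit in `A_∞`. -/

/-- Asymptotically multiplicative, central and invariant sequences of linear maps induce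
⋆-homomorphisms into the fixed point algebra. -/
theorem exists_starAlgHom_of_asymptotic {A : Type*} [CStarAlgebra A] {G : Type*} [Group G]
    {α : G →* (A ≃⋆ₐ[ℂ] A)} {B : Type*} [CStarAlgebra B] (φ : ℕ → B →ₗ[ℂ] A)
    {u : ℕ → B} (hu : DenseRange u) {v : ℕ → A} (hv : DenseRange v)
    (hstar : ∀ k b, φ k (star b) = star (φ k b)) (hbd : ∀ k b, ‖φ k b‖ ≤ 4 * ‖b‖)
    (hone : Tendsto (fun k => ‖φ k 1 - 1‖) atTop (𝓝 0))
    (hmul : ∀ i j, Tendsto (fun k => ‖φ k (u i * u j) - φ k (u i) * φ k (u j)‖) atTop (𝓝 0))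
    (hcomm : ∀ i j, Tendsto (fun k => ‖φ k (u i) * v j - v j * φ k (u i)‖) atTop (𝓝 0))
    (hinv : ∀ i g, Tendsto (fun k => ‖α g (φ k (u i)) - φ k (u i)‖) atTop (𝓝 0)) :
    ∃ Φ : B →⋆ₐ[ℂ] fixedCentralSeqAlgebra α, ∀ b, Φ b = 0 →
      Tendsto (fun k => ‖φ k b‖) atTop (𝓝 0) := by
  let Y : B →ₗ[ℂ] EllInfty A :=
    { toFun := fun b => BoundedContinuousFunction.ofNormedAddCommGroup (fun k => φ k b)
        continuous_of_discreteTopology (4 * ‖b‖) (fun k => hbd k b)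
      map_add' := fun b c => by ext k; simp
      map_smul' := fun z b => by ext k; simp }
  have hYapp : ∀ b k, Y b k = φ k b := fun b k => rfl
  have hY : Continuous Y := AddMonoidHomClass.continuous_of_bound Y 4 fun b =>
    (BoundedContinuousFunction.norm_le (by positivity)).2 fun k => hbd k b
  have hYstar : ∀ b, Y (star b) = star (Y b) := fun b => by
    ext k
    exact hstar k b
  have hYone : proj A (Y 1) = 1 := by
    rw [← sub_eq_zero, ← map_one (proj A), ← map_sub, proj_eq_zero_iff]
    exact hone
  have hYmul : ∀ b c, proj A (Y (b * c)) = proj A (Y b) * proj A (Y c) := fun b c => by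
    rw [← sub_eq_zero, ← map_mul, ← map_sub, proj_eq_zero_iff]
    -- Since `Y` is continuous and `cZero A` is closed, the relation holds for all elements once it
    -- holds on the dense sequence.
    exact hu.induction_on₂ (p := fun b c => Y (b * c) - Y b * Y c ∈ cZero A)
      ((isClosed_cZero A).preimage (by fun_prop)) hmul b c
  have hYcomm : ∀ b a, proj A (Y b) * iota A a = iota A a * proj A (Y b) := fun b a => by
    rw [← sub_eq_zero, show iota A a = proj A (constSeq A a) from rfl, ← map_mul, ← map_mul,
      ← map_sub, proj_eq_zero_iff]
    have hc : Continuous (constSeq A) :=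
      (AddMonoidHomClass.isometry_of_norm _ fun a => norm_const_eq a).continuous
    have h1 : ∀ i, Y (u i) * constSeq A a - constSeq A a * Y (u i) ∈ cZero A := fun i =>
      hv.induction_on (p := fun a => Y (u i) * constSeq A a - constSeq A a * Y (u i) ∈ cZero A) a
        ((isClosed_cZero A).preimage (by fun_prop)) (hcomm i)
    exact hu.induction_on (p := fun b => Y b * constSeq A a - constSeq A a * Y b ∈ cZero A) b
      ((isClosed_cZero A).preimage (by fun_prop)) h1
  have hYinv : ∀ b g, inftyAction α g (proj A (Y b)) = proj A (Y b) := fun b g => by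
    have hc : Continuous (ellAction α g) :=
      AddMonoidHomClass.continuous_of_bound _ 1 fun x => by
        simpa using NonUnitalStarAlgHom.norm_apply_le (ellAction α g) x
    rw [← sub_eq_zero, show inftyAction α g (proj A (Y b)) = proj A (ellAction α g (Y b)) from rfl,
      ← map_sub, proj_eq_zero_iff]
    exact hu.induction_on (p := fun b => ellAction α g (Y b) - Y b ∈ cZero A) b
      ((isClosed_cZero A).preimage (by fun_prop)) fun i => hinv i g
  have hcentral : ∀ b, proj A (Y b) ∈ centralSeqAlgebra A := fun b => by
    refine (StarSubalgebra.mem_centralizer_iff ℂ).2 ?_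
    rintro _ ⟨a, rfl⟩
    exact ⟨(hYcomm b a).symm, by rw [← map_star]; exact (hYcomm b _).symm⟩
  let Ψ : B →⋆ₐ[ℂ] AInfty A :=
    { toFun := fun b => proj A (Y b)
      map_one' := hYone
      map_mul' := hYmul
      map_zero' := by simp
      map_add' := fun b c => by rw [map_add, map_add]
      commutes' := fun z => by
        rw [Algebra.algebraMap_eq_smul_one, Algebra.algebraMap_eq_smul_one, map_smul, map_smul,
          hYone]
      map_star' := fun b => by rw [hYstar, map_star] }
  refine ⟨Ψ.codRestrict (fixedCentralSeqAlgebra α) fun b => ⟨hcentral b, hYinv b⟩, fun b hb => ?_⟩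
  have h : proj A (Y b) = 0 := congrArg Subtype.val hb
  exact proj_eq_zero_iff.1 h

end CentralSeq

end

/-! ### Diagonal sequence and injectivity. -/

theorem theorem3p3 {A : Type*} [CStarAlgebra A] [TopologicalSpace.SeparableSpace A]
    {G : Type*} [Group G] [TopologicalSpace G] [IsTopologicalGroup G] [CompactSpace G] [T2Space G]
    [SecondCountableTopology G]
    (α : G →* (A ≃⋆ₐ[ℂ] A)) (hcont : CentralSeq.StronglyContinuous α)
    (hRok : CentralSeq.HasRokhlinProperty α)
    {B : Type*} [CStarAlgebra B] [TopologicalSpace.SeparableSpace B]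
    (hB : CentralSeq.AdmitsCentralSequence B A) :
    ∃ φ : B →⋆ₐ[ℂ] CentralSeq.fixedCentralSeqAlgebra α, Function.Injective φ := by
  classical
  set u := TopologicalSpace.denseSeq B
  set v := TopologicalSpace.denseSeq A
  have hu : DenseRange u := TopologicalSpace.denseRange_denseSeq B
  have hv : DenseRange v := TopologicalSpace.denseRange_denseSeq A
  -- Stage `k` tests the norm of `u k.unpair.1` only, so every index recurs at arbitrarily late
  -- stages.
  choose φ hstar hbd hone hmul hcomm hinv hlow using fun k : ℕ =>
    CentralSeq.exists_linearMap_approx hcont hRok hB ((Finset.range k).image u)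
      ((Finset.range k).image v) (ε := 1 / ((k : ℝ) + 1)) (by positivity) (u k.unpair.1)
  have hlim := tendsto_one_div_add_atTop_nhds_zero_nat (𝕜 := ℝ)
  obtain ⟨Φ, hΦ⟩ := CentralSeq.exists_starAlgHom_of_asymptotic (α := α) φ hu hv hstar hbd
    (squeeze_zero (fun _ => norm_nonneg _) hone hlim)
    (fun i j => by
      refine squeeze_zero' (.of_forall fun _ => norm_nonneg _) ?_ hlim
      filter_upwards [eventually_gt_atTop i, eventually_gt_atTop j] with k hi hj
      exact hmul k _ (Finset.mem_image_of_mem _ (Finset.mem_range.2 hi)) _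
        (Finset.mem_image_of_mem _ (Finset.mem_range.2 hj)))
    (fun i j => by
      refine squeeze_zero' (.of_forall fun _ => norm_nonneg _) ?_ hlim
      filter_upwards [eventually_gt_atTop i, eventually_gt_atTop j] with k hi hj
      exact hcomm k _ (Finset.mem_image_of_mem _ (Finset.mem_range.2 hi)) _
        (Finset.mem_image_of_mem _ (Finset.mem_range.2 hj)))
    (fun i g => by
      refine squeeze_zero' (.of_forall fun _ => norm_nonneg _) ?_ hlim
      filter_upwards [eventually_gt_atTop i] with k hi
      exact hinv k _ (Finset.mem_image_of_mem _ (Finset.mem_range.2 hi)) g)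
  refine ⟨Φ, (injective_iff_map_eq_zero Φ).2 fun b hb => ?_⟩
  have hb0 := hΦ b hb
  by_contra hne
  have hpos : 0 < ‖b‖ := norm_pos_iff.2 hne
  obtain ⟨i, hi⟩ := Metric.denseRange_iff.1 hu b (‖b‖ / 40) (by positivity)
  obtain ⟨N, hN⟩ := eventually_atTop.1
    ((hb0.eventually_lt_const (u := ‖b‖ / 40) (by positivity)).and
      (hlim.eventually_lt_const (u := ‖b‖ / 40) (by positivity)))
  -- The stage `Nat.pair i N` is at least `N` and tests `u i`. In units of `‖b‖/40`, the estimates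
  -- give `‖φ k (u i)‖ < 5` and `‖u i‖ < 4 · 5 + 1`, hence `‖b‖ < 22`, whereas `‖b‖` is 40.
  obtain ⟨hk1, hk2⟩ := hN (Nat.pair i N) (Nat.right_le_pair i N)
  have h := hlow (Nat.pair i N)
  rw [Nat.unpair_pair] at h
  set k := Nat.pair i N
  rw [dist_eq_norm] at hi
  have e1 : ‖b‖ ≤ ‖b - u i‖ + ‖u i‖ := by simpa using norm_add_le (b - u i) (u i)
  have e2 : ‖φ k (u i)‖ ≤ ‖φ k b‖ + 4 * ‖b - u i‖ := by
    have := norm_sub_le (φ k b) (φ k (b - u i))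
    rw [← map_sub, sub_sub_cancel] at this
    linarith [hbd k (b - u i)]
  dsimp only at h
  linarith
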